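/- Let $A\in\mathbb R^{N\times N}$ (possibly singular) and $b,x_0\in\mathbb R^N$, put $r_0=b-Ax_0$, and consider the real linear system $Ax=b$. Let $q\in\mathbb R^N$ be a random vector whose entries are independent and identically distributed with law $N(0,1)$, and let $\varepsilon_1,\varepsilon_2,\dots$ be arbitrary real random numbers (the perturbations), defined on the same probability space. Consider the algorithm ML($n$)BiCGStab with $n=1$ (that is, BiCGStab) and the single shadow vector $q$, in exact arithmetic: Set $g_0=r_0$, $w_0=Ag_0$, $c_0=q^Tw_0$. For $k=1,2,\dots$, until the residual $r_{k-1}$ is zero (in which case the algorithm stops and returns $x_{k-1}$): 1. $\alpha_k=q^Tr_{k-1}/c_{k-1}$, $\quad u_k=r_{k-1}-\alpha_kw_{k-1}$, $\quad x_k=x_{k-1}+\alpha_kg_{k-1}$; if $u_k=0$, stop and return this $x_k$; 2. $\rho_k=-(Au_k)^Tu_k/\|Au_k\|_2^2$; replace $\rho_k$ by $\rho_k+\varepsilon_k$; 3. replace $x_k$ by $x_k-\rho_ku_k$, and set $r_k=\rho_kAu_k+u_k$; 4. $\tilde\beta_k=-q^Tr_k/c_{k-1}$, $\quad g_k=r_k+\tilde\beta_kw_{k-1}+(\tilde\beta_k/\rho_k)\,g_{k-1}$,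 $\quad w_k=Ag_k$, $\quad c_k=q^Tw_k$. The algorithm breaks down if one of the divisors $c_{k-1}$, $\|Au_k\|_2^2$, $\rho_k$ is zero when it is about to be used. Suppose that, almost surely, every perturbed $\rho_k$ that the algorithm computes satisfies $\rho_k\neq0$ and $-1/\rho_k\notin\sigma(A)$, where $\sigma(A)$ is the spectrum of $A$. Suppose also that the affine space $x_0+\operatorname{span}\{A^tr_0 : t=0,1,2,\dots\}$ contains a solution of $Ax=b$. Then, almost surely, the algorithm never breaks down by a zero division, and it stops after finitely many iterations and returns a solution of $Ax=b$ that lies in this affine space. -/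

import Mathlib

open MeasureTheory ProbabilityTheory Matrix

/-! ML(`n`)BiCGStab for `n = 1`, in exact arithmetic, for the real system `A x = b`, with one shadow
vector `q`.  For `n = 1` the index functions are `g_1(k) = k - 1` and `r_1(k) = 1 = n`, so that every
iteration executes the branch `r_n(k) = 1` of the first conditional and the branch `r_n(k) = n` of
the second one, whose inner loop (`s = k, …, k - 1`) is empty. -/

namespace MLBiCGStab

/-- The quantities `x_k, r_k, g_k, w_k, c_k` that iteration `k` leaves to iteration `k + 1`. -/
structure Iterate (N : ℕ) where
  x : Fin N → ℝ
  r : Fin N → ℝ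
  g : Fin N → ℝ
  w : Fin N → ℝ
  c : ℝ

/-- The algorithm is either still running, or it has stopped with an approximate solution `x`
because the residual vanishes, or it has met a division by zero. -/
inductive State (N : ℕ) where
  | running (s : Iterate N) : State N
  | finished (x : Fin N → ℝ) : State N
  | breakdown : State N

variable {N : ℕ}

/-- `r₀ = b - A x₀`. -/
def initialResidual (A : Matrix (Fin N) (Fin N) ℝ) (b x₀ : Fin N → ℝ) : Fin N → ℝ :=
  b - A *ᵥ x₀

/-- `g₀ = r₀`, `w₀ = A g₀`, `c₀ = qᵀ w₀`. -/
def initialIterate (A : Matrix (Fin N) (Fin N) ℝ) (b x₀ q : Fin N → ℝ) : Iterate N where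
  x := x₀
  r := initialResidual A b x₀
  g := initialResidual A b x₀
  w := A *ᵥ initialResidual A b x₀
  c := q ⬝ᵥ (A *ᵥ initialResidual A b x₀)

/-- `α_k = qᵀ r_{k-1} / c_{k-1}`. -/
noncomputable def alpha (q : Fin N → ℝ) (s : Iterate N) : ℝ :=
  (q ⬝ᵥ s.r) / s.c

/-- `u_k = r_{k-1} - α_k w_{k-1}`. -/
noncomputable def uVec (q : Fin N → ℝ) (s : Iterate N) : Fin N → ℝ :=
  s.r - alpha q s • s.w

/-- The intermediate approximation `x_{k-1} + α_k g_{k-1}`, whose residual is `u_k`. -/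
noncomputable def xHalf (q : Fin N → ℝ) (s : Iterate N) : Fin N → ℝ :=
  s.x + alpha q s • s.g

/-- `‖A u_k‖₂²`. -/
noncomputable def normSqAu (A : Matrix (Fin N) (Fin N) ℝ) (q : Fin N → ℝ) (s : Iterate N) : ℝ :=
  (A *ᵥ uVec q s) ⬝ᵥ (A *ᵥ uVec q s)

/-- `ρ_k = -(A u_k)ᵀ u_k / ‖A u_k‖₂² + ε`: the computed value, to which `ε` is added. -/
noncomputable def rho (A : Matrix (Fin N) (Fin N) ℝ) (q : Fin N → ℝ) (ε : ℝ) (s : Iterate N) : ℝ :=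
  -((A *ᵥ uVec q s) ⬝ᵥ uVec q s) / normSqAu A q s + ε

/-- `r_k = ρ_k A u_k + u_k`. -/
noncomputable def nextResidual (A : Matrix (Fin N) (Fin N) ℝ) (q : Fin N → ℝ) (ε : ℝ)
    (s : Iterate N) : Fin N → ℝ :=
  rho A q ε s • (A *ᵥ uVec q s) + uVec q s

/-- `β_k = -qᵀ r_k / c_{k-1}`. -/
noncomputable def beta (A : Matrix (Fin N) (Fin N) ℝ) (q : Fin N → ℝ) (ε : ℝ)
    (s : Iterate N) : ℝ :=
  -(q ⬝ᵥ nextResidual A q ε s) / s.c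

/-- `g_k = r_k + β_k w_{k-1} + (β_k / ρ_k) g_{k-1}`. -/
noncomputable def nextDirection (A : Matrix (Fin N) (Fin N) ℝ) (q : Fin N → ℝ) (ε : ℝ)
    (s : Iterate N) : Fin N → ℝ :=
  nextResidual A q ε s + beta A q ε s • s.w + (beta A q ε s / rho A q ε s) • s.g

/-- `x_k = x_{k-1} + α_k g_{k-1} - ρ_k u_k`, and `w_k = A g_k`, `c_k = qᵀ w_k`. -/
noncomputable def nextIterate (A : Matrix (Fin N) (Fin N) ℝ) (q : Fin N → ℝ) (ε : ℝ)
    (s : Iterate N) : Iterate N where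
  x := xHalf q s - rho A q ε s • uVec q s
  r := nextResidual A q ε s
  g := nextDirection A q ε s
  w := A *ᵥ nextDirection A q ε s
  c := q ⬝ᵥ (A *ᵥ nextDirection A q ε s)

/-- One iteration.  It stops when `r_{k-1} = 0`, and also when `u_k = 0`, where the intermediate
approximation is exact.  The divisors are `c_{k-1}`, `‖A u_k‖₂²` and `ρ_k`, and the algorithm breaks
down as soon as one of them is zero when it is about to be used. -/
noncomputable def step (A : Matrix (Fin N) (Fin N) ℝ) (q : Fin N → ℝ) (ε : ℝ) :
    State N → State N
  | .finished x => .finished x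
  | .breakdown => .breakdown
  | .running s =>
    if s.r = 0 then .finished s.x
    else if s.c = 0 then .breakdown
    else if uVec q s = 0 then .finished (xHalf q s)
    else if normSqAu A q s = 0 then .breakdown
    else if rho A q ε s = 0 then .breakdown
    else .running (nextIterate A q ε s)

/-- The state after `k` iterations; `ε k` is the number added to `ρ_k` in iteration `k ≥ 1`. -/
noncomputable def run (A : Matrix (Fin N) (Fin N) ℝ) (b x₀ q : Fin N → ℝ) (ε : ℕ → ℝ) :
    ℕ → State N
  | 0 => .running (initialIterate A b x₀ q)
  | k + 1 => step A q (ε (k + 1)) (run A b x₀ q ε k)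

/-- `ρ` is the (perturbed) value `ρ_{k+1}` that the algorithm computes in iteration `k + 1`: the
iteration is entered, does not stop, and does not break down before `ρ` is computed. -/
def ComputesRho (A : Matrix (Fin N) (Fin N) ℝ) (b x₀ q : Fin N → ℝ) (ε : ℕ → ℝ)
    (k : ℕ) (ρ : ℝ) : Prop :=
  ∃ s : Iterate N, run A b x₀ q ε k = .running s ∧
    s.r ≠ 0 ∧ s.c ≠ 0 ∧ uVec q s ≠ 0 ∧ normSqAu A q s ≠ 0 ∧ ρ = rho A q (ε (k + 1)) s

/-- The affine space `x₀ + span {Aᵗ r₀ | t = 0, 1, 2, …}`. -/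
def krylovAffine (A : Matrix (Fin N) (Fin N) ℝ) (b x₀ : Fin N → ℝ) :
    AffineSubspace ℝ (Fin N → ℝ) :=
  AffineSubspace.mk' x₀
    (Submodule.span ℝ (Set.range fun t : ℕ => (A ^ t) *ᵥ initialResidual A b x₀))

end MLBiCGStab

/-! Every vector in play is `p(A) r₀` for a polynomial `p`. Let `m` be the annihilator of `r₀` of
least degree `d`, and let `L p = qᵀ p(A) r₀`. Then `r_k` and `g_k` come from `ψ φ` and `ψ π`. Here
`ψ` is the product of the factors `ρ_i X + 1`, and `φ`, `π` are the BiCG polynomials, orthogonal to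
lower powers for `L` and for the shifted functional `L (X ·)` respectively.

If both functionals are nondegenerate in every order up to `d`, then `c_k ≠ 0` and the degrees of
`φ`, `π` never drop. By iteration `d`, `φ` is orthogonal to `d` powers, which forces `φ(A) r₀ = 0`,
so `u = 0`.

Nondegeneracy means nonzero Hankel determinants. These are nonzero polynomials in `q` because the
Krylov vectors involved are independent (`hankelDet_ne_zero`), and Gaussian vectors avoid their
zeros (`ae_eval_ne_zero`). The determinants involve only `q`, so the perturbations may depend on
`q`.

A singular `A` does no harm: a solution in the affine Krylov space gives `r₀ = A f(A) r₀`, hence `A`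
is injective on the Krylov space. This keeps the shifted vectors independent and gives `A u ≠ 0` for
`u ≠ 0`. -/

namespace MLBiCGStab

variable {N : ℕ}

/-! ### Hankel determinants of a Gaussian vector -/

/-- A nonzero polynomial vanishes only on a null set of a product of atomless measures. -/
theorem ae_eval_ne_zero {n : ℕ} (μ : Measure ℝ) [IsProbabilityMeasure μ] [NullSingletonClass μ]
    (p : MvPolynomial (Fin n) ℝ) (hp : p ≠ 0) :
    ∀ᵐ x ∂(Measure.pi fun _ : Fin n => μ), MvPolynomial.eval x p ≠ 0 := by
  induction n with
  | zero =>
    refine Filter.Eventually.of_forall fun x hx => hp ?_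
    refine MvPolynomial.funext fun y => ?_
    rw [Subsingleton.elim y x, hx, map_zero]
  | succ n ih =>
    have hmeas : MeasurableSet {z : ℝ × (Fin n → ℝ) |
        MvPolynomial.eval (Fin.cons z.1 z.2 : Fin (n + 1) → ℝ) p ≠ 0} := by
      refine (isOpen_ne_fun ?_ continuous_const).measurableSet
      exact (MvPolynomial.continuous_eval p).comp (Continuous.finCons (A := fun _ : Fin (n + 1) => ℝ) continuous_fst continuous_snd)
    have hprod : ∀ᵐ z ∂(μ.prod (Measure.pi fun _ : Fin n => μ)),
        MvPolynomial.eval (Fin.cons z.1 z.2 : Fin (n + 1) → ℝ) p ≠ 0 := by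
      -- With the last `n` coordinates frozen, a univariate polynomial remains; induction keeps its
      -- leading coefficient nonzero, so its roots are finitely many.
      rw [Measure.ae_prod_iff_ae_ae hmeas, Measure.ae_ae_comm hmeas]
      set f := MvPolynomial.finSuccEquiv ℝ n p with hf
      have hf0 : f ≠ 0 := by simpa [hf] using hp
      filter_upwards [ih f.leadingCoeff (by simpa using hf0)] with s hs
      have hmap : f.map (MvPolynomial.eval s) ≠ 0 := by
        intro h
        have := congrArg (fun g => Polynomial.coeff g f.natDegree) h
        simp only [Polynomial.coeff_map, Polynomial.coeff_zero] at this
        exact hs this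
      have hfin : {y : ℝ | (f.map (MvPolynomial.eval s)).IsRoot y}.Finite :=
        Polynomial.finite_setOfPred_isRoot hmap
      have hnull := hfin.measure_zero μ
      rw [ae_iff]
      convert hnull using 3
      simp [MvPolynomial.eval_eq_eval_mv_eval', hf, Polynomial.IsRoot]
    have hpres := measurePreserving_piFinSuccAbove (fun _ : Fin (n + 1) => μ) 0
    have := hpres.quasiMeasurePreserving.ae hprod
    filter_upwards [this] with x hx
    convert hx using 3
    ext i
    refine Fin.cases ?_ (fun j => ?_) i <;>
      simp [MeasurableEquiv.piFinSuccAbove, Fin.insertNthEquiv, Fin.tail]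

/-- The Hankel matrix of the numbers `qᵀ v_0, qᵀ v_1, …`. -/
def hankel (q : Fin N → ℝ) (v : ℕ → Fin N → ℝ) (k : ℕ) : Matrix (Fin k) (Fin k) ℝ :=
  Matrix.of fun i j => q ⬝ᵥ v (i + j)

/-- The determinant of `hankel q v k` as a polynomial in the entries of `q`. -/
noncomputable def hankelDet (v : ℕ → Fin N → ℝ) (k : ℕ) : MvPolynomial (Fin N) ℝ :=
  (Matrix.of fun i j : Fin k => ∑ l, MvPolynomial.X l * MvPolynomial.C (v (i + j) l)).det

theorem eval_hankelDet (q : Fin N → ℝ) (v : ℕ → Fin N → ℝ) (k : ℕ) :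
    MvPolynomial.eval q (hankelDet v k) = (hankel q v k).det := by
  rw [hankelDet, RingHom.map_det]
  congr 1
  ext i j
  simp [hankel, dotProduct]

/-- Linearly independent vectors can be given arbitrary inner products. -/
theorem exists_dotProduct_eq {k : ℕ} (v : Fin k → Fin N → ℝ) (hv : LinearIndependent ℝ v)
    (a : Fin k → ℝ) : ∃ q : Fin N → ℝ, ∀ i, q ⬝ᵥ v i = a i := by
  obtain ⟨f, hf⟩ : ∃ f : (Fin N → ℝ) →ₗ[ℝ] ℝ, ∀ i, f (v i) = a i := by
    let B := Module.Basis.span hv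
    obtain ⟨f, hf⟩ := LinearMap.exists_extend (B.constr ℝ a)
    refine ⟨f, fun i => ?_⟩
    have h1 : (B i : Fin N → ℝ) = v i := by
      simp [B, Module.Basis.span_apply]
    have h2 := LinearMap.congr_fun hf (B i)
    rw [Module.Basis.constr_basis] at h2
    rw [← h2, ← h1]
    rfl
  refine ⟨fun l => f (Pi.single l 1), fun i => ?_⟩
  rw [← hf i, LinearMap.pi_apply_eq_sum_univ f (v i)]
  simp only [dotProduct, smul_eq_mul]
  refine Finset.sum_congr rfl fun l _ => ?_
  rw [mul_comm]
  congr 2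
  ext m
  simp [Pi.single_apply, eq_comm]

/-- One good `q` suffices. Prescribing the inner products `0, …, 0, 1` puts ones on the antidiagonal
and zeros above it, so reversing the columns gives a triangular matrix. -/
theorem hankelDet_ne_zero (v : ℕ → Fin N → ℝ) (k : ℕ)
    (hv : LinearIndependent ℝ fun i : Fin k => v i) : hankelDet v k ≠ 0 := by
  obtain ⟨q, hq⟩ := exists_dotProduct_eq _ hv fun i => if (i : ℕ) + 1 = k then 1 else 0
  intro h
  have hdet : (hankel q v k).det = 0 := by rw [← eval_hankelDet, h, map_zero]
  have hrev : ((hankel q v k).submatrix id Fin.revPerm).det ≠ 0 := by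
    rw [Matrix.det_of_isLowerTriangular]
    · refine Finset.prod_ne_zero_iff.2 fun i _ => ?_
      have hi := i.2
      have := hq ⟨k - 1, by omega⟩
      simp only [hankel, submatrix_apply, of_apply, id, Fin.revPerm_apply, Fin.val_rev]
      rw [show (i : ℕ) + (k - (i + 1)) = k - 1 by omega, this, if_pos (show k - 1 + 1 = k by omega)]
      exact one_ne_zero
    · intro i j hij
      have hij : (i : ℕ) < j := hij
      have hj := j.2
      have := hq ⟨i + (k - (j + 1)), by omega⟩
      simp only [hankel, submatrix_apply, of_apply, id, Fin.revPerm_apply, Fin.val_rev]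
      rw [this, if_neg (show ¬((i : ℕ) + (k - (j + 1)) + 1 = k) by omega)]
  exact hrev (by rw [Matrix.det_permute', hdet, mul_zero])

/-- For a Gaussian `q` the Hankel determinants are almost surely nonzero. -/
theorem ae_det_hankel_ne_zero {Ω : Type*} [MeasurableSpace Ω] {P : Measure Ω}
    [IsProbabilityMeasure P] {q : Ω → Fin N → ℝ}
    (hq_law : ∀ i, HasLaw (fun ω => q ω i) (gaussianReal 0 1) P)
    (hq_indep : iIndepFun (fun (i : Fin N) (ω : Ω) => q ω i) P)
    (v : ℕ → Fin N → ℝ) (k : ℕ) (hv : LinearIndependent ℝ fun i : Fin k => v i) :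
    ∀ᵐ ω ∂P, (hankel (q ω) v k).det ≠ 0 := by
  have : NullSingletonClass (gaussianReal 0 1) := nullSingletonClass_gaussianReal one_ne_zero
  have hmap : P.map q = Measure.pi fun _ : Fin N => gaussianReal 0 1 := by
    have := (iIndepFun_iff_map_fun_eq_pi_map fun i => (hq_law i).aemeasurable).1 hq_indep
    simpa only [(hq_law _).map_eq] using this
  have hq : AEMeasurable q P := aemeasurable_pi_lambda _ fun i => (hq_law i).aemeasurable
  have := ae_eval_ne_zero (gaussianReal 0 1) _ (hankelDet_ne_zero v k hv)
  rw [← hmap] at this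
  filter_upwards [ae_of_ae_map hq this] with ω hω
  rwa [← eval_hankelDet]

/-! ### Krylov vectors and moments as functions of polynomials -/

open Polynomial

/-- The map `p ↦ p(A) r`. -/
noncomputable def krylovMap (A : Matrix (Fin N) (Fin N) ℝ) (r : Fin N → ℝ) :
    ℝ[X] →ₗ[ℝ] (Fin N → ℝ) where
  toFun p := aeval A p *ᵥ r
  map_add' p p' := by rw [map_add, add_mulVec]
  map_smul' a p := by rw [map_smul, smul_mulVec, RingHom.id_apply]

/-- The moment functional `p ↦ qᵀ p(A) r`. -/
noncomputable def moment (A : Matrix (Fin N) (Fin N) ℝ) (r q : Fin N → ℝ) : ℝ[X] →ₗ[ℝ] ℝ where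
  toFun p := q ⬝ᵥ krylovMap A r p
  map_add' p p' := by rw [map_add, dotProduct_add]
  map_smul' a p := by rw [map_smul, dotProduct_smul, RingHom.id_apply]

theorem dotProduct_krylovMap (A : Matrix (Fin N) (Fin N) ℝ) (r q : Fin N → ℝ) (p : ℝ[X]) :
    q ⬝ᵥ krylovMap A r p = moment A r q p := rfl

theorem krylovMap_mul (A : Matrix (Fin N) (Fin N) ℝ) (r : Fin N → ℝ) (p p' : ℝ[X]) :
    krylovMap A r (p * p') = aeval A p *ᵥ krylovMap A r p' := by
  simp [krylovMap, mulVec_mulVec]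

theorem krylovMap_X_mul (A : Matrix (Fin N) (Fin N) ℝ) (r : Fin N → ℝ) (p : ℝ[X]) :
    krylovMap A r (X * p) = A *ᵥ krylovMap A r p := by
  rw [krylovMap_mul, aeval_X]

theorem krylovMap_X_pow (A : Matrix (Fin N) (Fin N) ℝ) (r : Fin N → ℝ) (t : ℕ) :
    krylovMap A r (X ^ t) = (A ^ t) *ᵥ r := by
  simp [krylovMap]

theorem krylovMap_one (A : Matrix (Fin N) (Fin N) ℝ) (r : Fin N → ℝ) :
    krylovMap A r 1 = r := by
  simp [krylovMap]

theorem krylovMap_mulVec (A : Matrix (Fin N) (Fin N) ℝ) (r : Fin N → ℝ) (p : ℝ[X]) :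
    krylovMap A (A *ᵥ r) p = krylovMap A r (p * X) := by
  simp [krylovMap, mulVec_mulVec]

theorem krylovMap_mul_eq_zero {A : Matrix (Fin N) (Fin N) ℝ} {r : Fin N → ℝ} {p : ℝ[X]}
    (h : krylovMap A r p = 0) (p' : ℝ[X]) : krylovMap A r (p' * p) = 0 := by
  rw [krylovMap_mul, h, mulVec_zero]

theorem range_krylovMap (A : Matrix (Fin N) (Fin N) ℝ) (r : Fin N → ℝ) :
    LinearMap.range (krylovMap A r) =
      Submodule.span ℝ (Set.range fun t : ℕ => (A ^ t) *ᵥ r) := by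
  apply le_antisymm
  · rintro _ ⟨p, rfl⟩
    rw [p.as_sum_range_C_mul_X_pow, map_sum]
    refine Submodule.sum_mem _ fun t _ => ?_
    rw [← smul_eq_C_mul, map_smul, krylovMap_X_pow]
    exact Submodule.smul_mem _ _ (Submodule.subset_span ⟨t, rfl⟩)
  · rw [Submodule.span_le]
    rintro _ ⟨t, rfl⟩
    exact ⟨X ^ t, krylovMap_X_pow A r t⟩

/-- `L` is nondegenerate in order `k`: a polynomial of degree less than `k` that is orthogonal to
all polynomials of degree less than `k` is zero. -/
def Nondegenerate (L : ℝ[X] →ₗ[ℝ] ℝ) (k : ℕ) : Prop :=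
  ∀ p : ℝ[X], p.degree < k → (∀ j < k, L (X ^ j * p) = 0) → p = 0

/-- The orthogonality conditions say that the Hankel matrix kills the coefficient vector of `p`. -/
theorem nondegenerate_of_det_hankel_ne_zero {q : Fin N → ℝ} {v : ℕ → Fin N → ℝ} {k : ℕ}
    (h : (hankel q v k).det ≠ 0) (L : ℝ[X] →ₗ[ℝ] ℝ) (hL : ∀ t, L (X ^ t) = q ⬝ᵥ v t) :
    Nondegenerate L k := by
  intro p hp hj
  have hzero : (fun i : Fin k => p.coeff i) = 0 := by
    refine Matrix.eq_zero_of_mulVec_eq_zero h ?_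
    ext i
    have := hj i i.2
    have hnat : p.natDegree < k := by
      rcases eq_or_ne p 0 with rfl | hp0
      · simpa using i.pos
      · exact (natDegree_lt_iff_degree_lt hp0).2 hp
    rw [p.as_sum_range' k hnat,
      Finset.mul_sum, map_sum, Finset.sum_range] at this
    rw [Pi.zero_apply, ← this, mulVec, dotProduct]
    refine Finset.sum_congr rfl fun j _ => ?_
    rw [← C_mul_X_pow_eq_monomial, mul_left_comm, ← pow_add, ← smul_eq_C_mul, map_smul, hL,
      smul_eq_mul, mul_comm]
    rfl
  ext t
  rw [coeff_zero]
  by_cases ht : t < k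
  · exact congrFun hzero ⟨t, ht⟩
  · exact coeff_eq_zero_of_degree_lt (hp.trans_le (by exact_mod_cast not_lt.1 ht))

/-- If `p` is orthogonal to lower powers, then only the top coefficient of `ψ` matters. -/
theorem map_mul_eq_coeff_mul {L : ℝ[X] →ₗ[ℝ] ℝ} {k : ℕ} {ψ p : ℝ[X]} (hψ : ψ.natDegree ≤ k)
    (hp : ∀ j < k, L (X ^ j * p) = 0) : L (ψ * p) = ψ.coeff k * L (X ^ k * p) := by
  have hsum : L (ψ * p) = ∑ i ∈ Finset.range (k + 1), ψ.coeff i * L (X ^ i * p) := by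
    conv_lhs => rw [ψ.as_sum_range_C_mul_X_pow' (by omega : ψ.natDegree < k + 1)]
    rw [Finset.sum_mul, map_sum]
    refine Finset.sum_congr rfl fun i _ => ?_
    rw [mul_assoc, ← smul_eq_C_mul, map_smul, smul_eq_mul]
  rw [hsum, Finset.sum_range_succ, Finset.sum_eq_zero, zero_add]
  intro i hi
  rw [hp i (Finset.mem_range.1 hi), mul_zero]

/-- The grade of `r`: there is an annihilating polynomial of least degree. -/
theorem exists_minimal_annihilator (A : Matrix (Fin N) (Fin N) ℝ) (r : Fin N → ℝ) :
    ∃ m : ℝ[X], m ≠ 0 ∧ krylovMap A r m = 0 ∧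
      ∀ p : ℝ[X], p.degree < m.natDegree → krylovMap A r p = 0 → p = 0 := by
  classical
  have hex : ∃ d : ℕ, ∃ m : ℝ[X], m ≠ 0 ∧ krylovMap A r m = 0 ∧ m.natDegree = d :=
    ⟨_, A.charpoly, A.charpoly_monic.ne_zero, by simp [krylovMap, aeval_self_charpoly], rfl⟩
  obtain ⟨m, hm0, hm, hd⟩ := Nat.find_spec hex
  refine ⟨m, hm0, hm, fun p hp hpr => ?_⟩
  by_contra hp0
  rw [hd] at hp
  exact Nat.find_min hex ((natDegree_lt_iff_degree_lt hp0).2 hp) ⟨p, hp0, hpr, rfl⟩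

/-! ### The BiCG polynomials behind one iteration -/

/-- What holds when iteration `k + 1` begins: residual and direction are the products of a
stabilizing polynomial `ψ` with the BiCG polynomials `φ` and `π`. -/
structure Invariant (A : Matrix (Fin N) (Fin N) ℝ) (b x₀ q : Fin N → ℝ) (k : ℕ)
    (s : Iterate N) (ψ φ π : ℝ[X]) : Prop where
  natDegree_ψ : ψ.natDegree ≤ k
  coeff_ψ : ψ.coeff k ≠ 0
  degree_φ : φ.degree ≤ k
  coeff_zero_φ : φ.coeff 0 = 1
  orthogonal_φ : ∀ j < k, moment A (initialResidual A b x₀) q (X ^ j * φ) = 0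
  degree_π : π.degree ≤ k
  coeff_π : π.coeff k ≠ 0
  orthogonal_π : ∀ j < k, moment A (initialResidual A b x₀) q (X ^ j * (X * π)) = 0
  r_eq : s.r = krylovMap A (initialResidual A b x₀) (ψ * φ)
  g_eq : s.g = krylovMap A (initialResidual A b x₀) (ψ * π)
  w_eq : s.w = A *ᵥ s.g
  c_eq : s.c = q ⬝ᵥ s.w
  residual_eq : b - A *ᵥ s.x = s.r
  x_mem : s.x ∈ krylovAffine A b x₀

theorem mem_krylovAffine_iff {A : Matrix (Fin N) (Fin N) ℝ} {b x₀ x : Fin N → ℝ} :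
    x ∈ krylovAffine A b x₀ ↔ x - x₀ ∈ LinearMap.range (krylovMap A (initialResidual A b x₀)) := by
  rw [range_krylovMap, krylovAffine, AffineSubspace.mem_mk', vsub_eq_sub]

theorem invariant_initial (A : Matrix (Fin N) (Fin N) ℝ) (b x₀ q : Fin N → ℝ) :
    Invariant A b x₀ q 0 (initialIterate A b x₀ q) 1 1 1 where
  natDegree_ψ := by simp
  coeff_ψ := by simp
  degree_φ := by simp
  coeff_zero_φ := by simp
  orthogonal_φ := by simp
  degree_π := by simp
  coeff_π := by simp
  orthogonal_π := by simp
  r_eq := by rw [mul_one, krylovMap_one]; rfl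
  g_eq := by rw [mul_one, krylovMap_one]; rfl
  w_eq := rfl
  c_eq := rfl
  residual_eq := rfl
  x_mem := AffineSubspace.self_mem_mk' _ _

namespace Invariant

variable {A : Matrix (Fin N) (Fin N) ℝ} {b x₀ q : Fin N → ℝ} {k : ℕ} {s : Iterate N}
  {ψ φ π : ℝ[X]}

local notation "E" => krylovMap A (initialResidual A b x₀)
local notation "L" => moment A (initialResidual A b x₀) q

theorem w_eq_krylovMap (h : Invariant A b x₀ q k s ψ φ π) : s.w = E (ψ * (X * π)) := by
  rw [h.w_eq, h.g_eq, mul_left_comm, krylovMap_X_mul]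

theorem c_eq_moment (h : Invariant A b x₀ q k s ψ φ π) :
    s.c = ψ.coeff k * L (X ^ k * (X * π)) := by
  rw [h.c_eq, h.w_eq_krylovMap, dotProduct_krylovMap,
    map_mul_eq_coeff_mul h.natDegree_ψ h.orthogonal_π]

/-- Were this moment zero too, `π` would be orthogonal to all `k + 1` powers for the shifted
functional, hence zero. -/
theorem moment_π_ne_zero (h : Invariant A b x₀ q k s ψ φ π)
    (h1 : Nondegenerate (L ∘ₗ LinearMap.mulLeft ℝ X) (k + 1)) :
    L (X ^ k * (X * π)) ≠ 0 := by
  intro h0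
  have hπ : π = 0 := by
    refine h1 π (h.degree_π.trans_lt (by exact_mod_cast Nat.lt_succ_self k)) fun j hj => ?_
    rw [LinearMap.comp_apply, LinearMap.mulLeft_apply, mul_left_comm]
    rcases Nat.lt_succ_iff_lt_or_eq.1 hj with hj | rfl
    · exact h.orthogonal_π j hj
    · exact h0
  exact h.coeff_π (by rw [hπ, coeff_zero])

theorem c_ne_zero (h : Invariant A b x₀ q k s ψ φ π)
    (h1 : Nondegenerate (L ∘ₗ LinearMap.mulLeft ℝ X) (k + 1)) : s.c ≠ 0 := by
  rw [h.c_eq_moment]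
  exact mul_ne_zero h.coeff_ψ (h.moment_π_ne_zero h1)

theorem uVec_eq (h : Invariant A b x₀ q k s ψ φ π) :
    uVec q s = E (ψ * (φ - C (alpha q s) * (X * π))) := by
  rw [uVec, h.r_eq, h.w_eq_krylovMap, ← map_smul, ← map_sub, smul_eq_C_mul]
  congr 1
  ring

/-- Only `j = k` is new, and `alpha` is chosen for it: the leading coefficient of `ψ` cancels from
its quotient. -/
theorem orthogonal_next_φ (h : Invariant A b x₀ q k s ψ φ π)
    (h1 : Nondegenerate (L ∘ₗ LinearMap.mulLeft ℝ X) (k + 1)) :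
    ∀ j < k + 1, L (X ^ j * (φ - C (alpha q s) * (X * π))) = 0 := by
  intro j hj
  rw [mul_sub, mul_left_comm, ← smul_eq_C_mul, map_sub, map_smul, smul_eq_mul]
  rcases Nat.lt_succ_iff_lt_or_eq.1 hj with hj | rfl
  · rw [h.orthogonal_φ j hj, h.orthogonal_π j hj, mul_zero, sub_zero]
  · rw [alpha, h.r_eq, dotProduct_krylovMap, map_mul_eq_coeff_mul h.natDegree_ψ h.orthogonal_φ,
      h.c_eq_moment, mul_div_mul_left _ _ h.coeff_ψ, div_mul_cancel₀ _ (h.moment_π_ne_zero h1),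
      sub_self]

theorem degree_next_φ (h : Invariant A b x₀ q k s ψ φ π) (a : ℝ) :
    (φ - C a * (X * π)).degree ≤ ((k + 1 : ℕ) : WithBot ℕ) := by
  refine (degree_sub_le _ _).trans (max_le (h.degree_φ.trans (by exact_mod_cast Nat.le_succ k)) ?_)
  rw [← smul_eq_C_mul]
  refine (degree_smul_le a _).trans ?_
  rw [degree_mul, degree_X, add_comm]
  exact_mod_cast add_le_add_left h.degree_π 1

theorem coeff_zero_next_φ (h : Invariant A b x₀ q k s ψ φ π) (a : ℝ) :
    (φ - C a * (X * π)).coeff 0 = 1 := by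
  simp [h.coeff_zero_φ]

/-- A drop in degree would make the polynomial zero by nondegeneracy, but its constant term is `1`.
-/
theorem coeff_next_φ (h : Invariant A b x₀ q k s ψ φ π)
    (h0 : Nondegenerate L (k + 1))
    (h1 : Nondegenerate (L ∘ₗ LinearMap.mulLeft ℝ X) (k + 1)) :
    (φ - C (alpha q s) * (X * π)).coeff (k + 1) ≠ 0 := by
  intro hc
  have hdeg : (φ - C (alpha q s) * (X * π)).degree < ((k + 1 : ℕ) : WithBot ℕ) := by
    refine lt_of_le_of_ne (h.degree_next_φ _) fun he => ?_
    exact coeff_ne_zero_of_eq_degree he hc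
  have hzero := h0 _ hdeg (h.orthogonal_next_φ h1)
  have := h.coeff_zero_next_φ (alpha q s)
  rw [hzero, coeff_zero] at this
  exact zero_ne_one this

theorem residual_xHalf (h : Invariant A b x₀ q k s ψ φ π) :
    b - A *ᵥ xHalf q s = uVec q s := by
  rw [xHalf, uVec, mulVec_add, mulVec_smul, ← h.w_eq, ← h.residual_eq, sub_add_eq_sub_sub]

theorem xHalf_mem (h : Invariant A b x₀ q k s ψ φ π) : xHalf q s ∈ krylovAffine A b x₀ := by
  have hx := mem_krylovAffine_iff.1 h.x_mem
  rw [mem_krylovAffine_iff, xHalf, add_sub_right_comm, h.g_eq]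
  exact Submodule.add_mem _ hx (Submodule.smul_mem _ _ ⟨_, rfl⟩)

theorem next (h : Invariant A b x₀ q k s ψ φ π) (h0 : Nondegenerate L (k + 1))
    (h1 : Nondegenerate (L ∘ₗ LinearMap.mulLeft ℝ X) (k + 1)) {ε : ℝ} (hρ : rho A q ε s ≠ 0) :
    ∃ ψ' φ' π' : ℝ[X], Invariant A b x₀ q (k + 1) (nextIterate A q ε s) ψ' φ' π' := by
  set ρ := rho A q ε s with hρ_def
  set φ' := φ - C (alpha q s) * (X * π) with hφ'
  set ψ' := (C ρ * X + 1) * ψ with hψ'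
  set π' := φ' + C (beta A q ε s / ρ) * π with hπ'
  have hu : uVec q s = E (ψ * φ') := h.uVec_eq
  have hr : nextResidual A q ε s = E (ψ' * φ') := by
    rw [nextResidual, hu, ← krylovMap_X_mul, ← map_smul, ← map_add, smul_eq_C_mul]
    congr 1
    rw [hψ']
    ring
  have hg : nextDirection A q ε s = E (ψ' * π') := by
    rw [nextDirection, hr, h.w_eq_krylovMap, h.g_eq, ← map_smul, ← map_smul, ← map_add, ← map_add,
      smul_eq_C_mul, smul_eq_C_mul]
    congr 1
    -- Thus `β w + (β / ρ) g = (β / ρ) (ρ A + 1) g`, which splits off the new factor of `ψ'`.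
    have hC : C (beta A q ε s) = C (beta A q ε s / ρ) * C ρ := by
      rw [← C_mul, div_mul_cancel₀ _ hρ]
    rw [hπ', hψ', ← hρ_def, hC]
    ring
  have hψdeg : ψ'.natDegree ≤ k + 1 := by
    refine natDegree_mul_le.trans ?_
    have : (C ρ * X + 1 : ℝ[X]).natDegree ≤ 1 := by
      simpa using natDegree_linear_le (a := ρ) (b := 1)
    have := h.natDegree_ψ
    omega
  have hψcoeff : ψ'.coeff (k + 1) = ρ * ψ.coeff k := by
    rw [hψ', add_mul, one_mul, mul_assoc, coeff_add, coeff_C_mul, coeff_X_mul,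
      coeff_eq_zero_of_natDegree_lt (Nat.lt_succ_of_le h.natDegree_ψ), add_zero]
  have hπcoeff : π.coeff (k + 1) = 0 :=
    coeff_eq_zero_of_degree_lt (h.degree_π.trans_lt (by exact_mod_cast Nat.lt_succ_self k))
  have hφorth : ∀ j < k + 1, L (X ^ j * φ') = 0 := h.orthogonal_next_φ h1
  have hresidual : b - A *ᵥ (nextIterate A q ε s).x = (nextIterate A q ε s).r := by
    change b - A *ᵥ (xHalf q s - ρ • uVec q s) = ρ • (A *ᵥ uVec q s) + uVec q s
    rw [mulVec_sub, mulVec_smul, ← h.residual_xHalf]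
    abel
  refine ⟨ψ', φ', π', hψdeg, ?_, h.degree_next_φ _, h.coeff_zero_next_φ _, hφorth, ?_, ?_, ?_,
    hr, hg, rfl, rfl, hresidual, ?_⟩
  · rw [hψcoeff]
    exact mul_ne_zero hρ h.coeff_ψ
  · refine (degree_add_le _ _).trans (max_le (h.degree_next_φ _) ?_)
    rw [← smul_eq_C_mul]
    refine (degree_smul_le _ _).trans ?_
    exact h.degree_π.trans (by exact_mod_cast Nat.le_succ k)
  · rw [hπ', coeff_add, coeff_C_mul, hπcoeff, mul_zero, add_zero]
    exact h.coeff_next_φ h0 h1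
  · intro j hj
    have hsplit : L (X ^ j * (X * π')) =
        L (X ^ (j + 1) * φ') + beta A q ε s / ρ * L (X ^ j * (X * π)) := by
      rw [← smul_eq_mul (beta A q ε s / ρ), ← map_smul, ← map_add, smul_eq_C_mul]
      congr 1
      rw [hπ']
      ring
    rw [hsplit]
    rcases Nat.lt_succ_iff_lt_or_eq.1 hj with hj | rfl
    · rw [hφorth _ (by omega), h.orthogonal_π j hj, mul_zero, add_zero]
    -- At `j = k` the choice of `beta` makes the two moments cancel; the factor `ρ` in the leading
    -- coefficient of `ψ'` offsets the division by `ρ`.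
    · have hL := h.moment_π_ne_zero h1
      have hψ0 := h.coeff_ψ
      rw [beta, hr, dotProduct_krylovMap, map_mul_eq_coeff_mul hψdeg hφorth, hψcoeff,
        h.c_eq_moment]
      field_simp
      ring
  · have hx := mem_krylovAffine_iff.1 h.xHalf_mem
    rw [mem_krylovAffine_iff]
    change xHalf q s - ρ • uVec q s - x₀ ∈ _
    rw [sub_right_comm, hu]
    exact Submodule.sub_mem _ hx (Submodule.smul_mem _ _ ⟨_, rfl⟩)

end Invariant

/-! ### Termination for a shadow vector in general position -/

/-- The algorithm succeeds for every shadow vector in general position. -/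
theorem run_succeeds {A : Matrix (Fin N) (Fin N) ℝ} {b x₀ q : Fin N → ℝ} {ε : ℕ → ℝ} {m : ℝ[X]}
    (hm0 : m ≠ 0) (hm : krylovMap A (initialResidual A b x₀) m = 0)
    (hinj : ∀ p, A *ᵥ krylovMap A (initialResidual A b x₀) p = 0 →
      krylovMap A (initialResidual A b x₀) p = 0)
    (h0 : ∀ k ≤ m.natDegree, Nondegenerate (moment A (initialResidual A b x₀) q) k)
    (h1 : ∀ k ≤ m.natDegree,
      Nondegenerate (moment A (initialResidual A b x₀) q ∘ₗ LinearMap.mulLeft ℝ X) k)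
    (hρ : ∀ (k : ℕ) (ρ : ℝ), ComputesRho A b x₀ q ε k ρ → ρ ≠ 0) :
    (∀ k, run A b x₀ q ε k ≠ State.breakdown) ∧
      ∃ (k : ℕ) (x : Fin N → ℝ), run A b x₀ q ε k = State.finished x ∧
        x ∈ krylovAffine A b x₀ ∧ A *ᵥ x = b := by
  -- Reducing modulo `m` changes no moment and brings the degree below `d`, where nondegeneracy
  -- applies.
  have hvanish : ∀ φ : ℝ[X],
      (∀ j < m.natDegree, moment A (initialResidual A b x₀) q (X ^ j * φ) = 0) →
        krylovMap A (initialResidual A b x₀) φ = 0 := by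
    intro φ hφ
    have hE : ∀ p : ℝ[X], krylovMap A (initialResidual A b x₀) (p * φ) =
        krylovMap A (initialResidual A b x₀) (p * (φ % m)) := by
      intro p
      conv_lhs => rw [← EuclideanDomain.div_add_mod φ m]
      rw [mul_add, map_add, mul_left_comm, mul_comm m, krylovMap_mul_eq_zero hm, zero_add]
    have hmod : φ % m = 0 := by
      refine h0 _ le_rfl _ ?_ fun j hj => ?_
      · rw [← degree_eq_natDegree hm0]
        exact EuclideanDomain.mod_lt φ hm0
      · rw [← hφ j hj, ← dotProduct_krylovMap, ← dotProduct_krylovMap, hE]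
    rw [← one_mul φ, hE, hmod, mul_zero, map_zero]
  -- A running state with nonzero residual has `k < d`, so order `k + 1` is available; the
  -- alternative `s.r = 0` is needed for `d = 0`.
  have key : ∀ k,
      (∃ x, run A b x₀ q ε k = State.finished x ∧ x ∈ krylovAffine A b x₀ ∧ A *ᵥ x = b) ∨
      (k ≤ m.natDegree ∧ ∃ s, run A b x₀ q ε k = State.running s ∧
        (s.r = 0 ∨ k < m.natDegree) ∧ ∃ ψ φ π, Invariant A b x₀ q k s ψ φ π) := by
    intro k
    induction k with
    | zero =>
      refine .inr ⟨Nat.zero_le _, _, rfl, ?_, _, _, _, invariant_initial A b x₀ q⟩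
      rcases Nat.eq_zero_or_pos m.natDegree with hd | hd
      · left
        have := hvanish 1 (by simp [hd])
        rwa [krylovMap_one] at this
      · exact .inr hd
    | succ k ih =>
      rcases ih with ⟨x, hx, hsol⟩ | ⟨-, s, hs, hr, ψ, φ, π, h⟩
      · exact .inl ⟨x, by rw [run, hx, step], hsol⟩
      rw [run, hs, step]
      by_cases hr0 : s.r = 0
      · refine .inl ⟨s.x, by rw [if_pos hr0], h.x_mem, ?_⟩
        exact (sub_eq_zero.1 (h.residual_eq.trans hr0)).symm
      have hk : k + 1 ≤ m.natDegree := hr.resolve_left hr0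
      have hc := h.c_ne_zero (h1 _ hk)
      rw [if_neg hr0, if_neg hc]
      by_cases hu : uVec q s = 0
      · refine .inl ⟨xHalf q s, by rw [if_pos hu], h.xHalf_mem, ?_⟩
        exact (sub_eq_zero.1 (h.residual_xHalf.trans hu)).symm
      have hn : normSqAu A q s ≠ 0 := by
        rw [normSqAu, Ne, dotProduct_self_eq_zero]
        intro hA
        rw [h.uVec_eq] at hA hu
        exact hu (hinj _ hA)
      have hρ0 := hρ k _ ⟨s, hs, hr0, hc, hu, hn, rfl⟩
      rw [if_neg hu, if_neg hn, if_neg hρ0]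
      -- If `k + 1 = d`, the new `φ` is orthogonal to `d` powers, so `u` would already be zero.
      refine .inr ⟨hk, _, rfl, .inr (lt_of_le_of_ne hk fun hd => hu ?_),
        h.next (h0 _ hk) (h1 _ hk) hρ0⟩
      rw [h.uVec_eq]
      exact krylovMap_mul_eq_zero (hvanish _ (hd ▸ h.orthogonal_next_φ (h1 _ hk))) ψ
  constructor
  · intro k hk
    rcases key k with ⟨x, hx, -⟩ | ⟨-, s, hs, -⟩ <;> simp_all
  · rcases key (m.natDegree + 1) with ⟨x, hx⟩ | ⟨hle, -⟩
    · exact ⟨_, x, hx⟩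
    · omega

/-! ### Singular matrices and almost sure nondegeneracy -/

/-- The residual of a Krylov-solvable system is the image of a Krylov vector. -/
theorem exists_krylovMap_X_mul_eq {A : Matrix (Fin N) (Fin N) ℝ} {b x₀ : Fin N → ℝ}
    (hsol : ∃ y ∈ krylovAffine A b x₀, A *ᵥ y = b) :
    ∃ f : ℝ[X], krylovMap A (initialResidual A b x₀) (X * f) = initialResidual A b x₀ := by
  obtain ⟨y, hy, rfl⟩ := hsol
  obtain ⟨f, hf⟩ := mem_krylovAffine_iff.1 hy
  refine ⟨f, ?_⟩
  rw [krylovMap_X_mul, hf, mulVec_sub, initialResidual]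

/-- If `r` lies in the image of its Krylov space, `A` is injective on that space. -/
theorem krylovMap_eq_zero_of_mulVec {A : Matrix (Fin N) (Fin N) ℝ} {r : Fin N → ℝ} {f : ℝ[X]}
    (hf : krylovMap A r (X * f) = r) {p : ℝ[X]} (hp : A *ᵥ krylovMap A r p = 0) :
    krylovMap A r p = 0 := by
  -- By commutativity this vector is also `p(A) (A f(A) r) = p(A) r`.
  have h1 : krylovMap A r (f * (X * p)) = 0 :=
    krylovMap_mul_eq_zero (by rw [krylovMap_X_mul, hp]) f
  rw [← mul_assoc, mul_comm, mul_comm f, krylovMap_mul, hf] at h1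
  exact h1

theorem linearIndependent_krylov {A : Matrix (Fin N) (Fin N) ℝ} {r : Fin N → ℝ} {d k : ℕ}
    (hmin : ∀ p : ℝ[X], p.degree < d → krylovMap A r p = 0 → p = 0) (hk : k ≤ d) :
    LinearIndependent ℝ fun i : Fin k => krylovMap A r (X ^ (i : ℕ)) := by
  have hX : LinearIndependent ℝ fun i : Fin k => (X : ℝ[X]) ^ (i : ℕ) := by
    have := (Polynomial.basisMonomials ℝ).linearIndependent.comp _ (Fin.val_injective (n := k))
    simpa [Function.comp_def, monomial_one_right_eq_X_pow] using this
  refine hX.map (f := krylovMap A r) ?_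
  rw [Submodule.disjoint_def]
  intro p hp hker
  refine hmin p ?_ hker
  have : p ∈ degreeLT ℝ d := by
    refine (Submodule.span_le.2 ?_) hp
    rintro _ ⟨i, rfl⟩
    rw [SetLike.mem_coe, mem_degreeLT, degree_X_pow]
    exact_mod_cast i.2.trans_le hk
  exact mem_degreeLT.1 this

/-- For a Gaussian `q` all Hankel determinants up to the grade of `r` are nonzero. -/
theorem ae_det_hankel_krylov_ne_zero {Ω : Type*} [MeasurableSpace Ω] {P : Measure Ω}
    [IsProbabilityMeasure P] {q : Ω → Fin N → ℝ}
    (hq_law : ∀ i, HasLaw (fun ω => q ω i) (gaussianReal 0 1) P)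
    (hq_indep : iIndepFun (fun (i : Fin N) (ω : Ω) => q ω i) P)
    {A : Matrix (Fin N) (Fin N) ℝ} {r : Fin N → ℝ} {d : ℕ}
    (hmin : ∀ p : ℝ[X], p.degree < d → krylovMap A r p = 0 → p = 0) :
    ∀ᵐ ω ∂P, ∀ k ≤ d, (hankel (q ω) (fun t => krylovMap A r (X ^ t)) k).det ≠ 0 := by
  refine ae_all_iff.2 fun k => ?_
  by_cases hk : k ≤ d
  · filter_upwards [ae_det_hankel_ne_zero hq_law hq_indep (fun t => krylovMap A r (X ^ t)) k
      (linearIndependent_krylov hmin hk)] with ω hω _ using hω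
  · exact .of_forall fun _ h => absurd h hk

/-- For a Gaussian `q` the moment functional is almost surely nondegenerate in every order up to the
grade of `r`. -/
theorem ae_nondegenerate_moment {Ω : Type*} [MeasurableSpace Ω] {P : Measure Ω}
    [IsProbabilityMeasure P] {q : Ω → Fin N → ℝ}
    (hq_law : ∀ i, HasLaw (fun ω => q ω i) (gaussianReal 0 1) P)
    (hq_indep : iIndepFun (fun (i : Fin N) (ω : Ω) => q ω i) P)
    {A : Matrix (Fin N) (Fin N) ℝ} {r : Fin N → ℝ} {d : ℕ}
    (hmin : ∀ p : ℝ[X], p.degree < d → krylovMap A r p = 0 → p = 0) :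
    ∀ᵐ ω ∂P, ∀ k ≤ d, Nondegenerate (moment A r (q ω)) k := by
  filter_upwards [ae_det_hankel_krylov_ne_zero hq_law hq_indep hmin] with ω h k hk
  exact nondegenerate_of_det_hankel_ne_zero (h k hk) _ fun t => rfl

/-- The same for the shifted moments, if `A` is injective on the Krylov space. -/
theorem ae_nondegenerate_shifted_moment {Ω : Type*} [MeasurableSpace Ω] {P : Measure Ω}
    [IsProbabilityMeasure P] {q : Ω → Fin N → ℝ}
    (hq_law : ∀ i, HasLaw (fun ω => q ω i) (gaussianReal 0 1) P)
    (hq_indep : iIndepFun (fun (i : Fin N) (ω : Ω) => q ω i) P)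
    {A : Matrix (Fin N) (Fin N) ℝ} {r : Fin N → ℝ} {d : ℕ}
    (hmin : ∀ p : ℝ[X], p.degree < d → krylovMap A r p = 0 → p = 0)
    (hinj : ∀ p, A *ᵥ krylovMap A r p = 0 → krylovMap A r p = 0) :
    ∀ᵐ ω ∂P, ∀ k ≤ d, Nondegenerate (moment A r (q ω) ∘ₗ LinearMap.mulLeft ℝ X) k := by
  -- The shifted moments of `r` are the moments of `A r`; by injectivity, an annihilator of `A r`
  -- annihilates `r`.
  have hmin' : ∀ p : ℝ[X], p.degree < d → krylovMap A (A *ᵥ r) p = 0 → p = 0 := by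
    intro p hp h
    refine hmin p hp (hinj p ?_)
    rwa [← krylovMap_X_mul, mul_comm, ← krylovMap_mulVec]
  filter_upwards [ae_det_hankel_krylov_ne_zero hq_law hq_indep hmin'] with ω h k hk
  refine nondegenerate_of_det_hankel_ne_zero (h k hk) _ fun t => ?_
  rw [krylovMap_mulVec, mul_comm]
  rfl

end MLBiCGStab

theorem mainTheorem6
    {N : ℕ} (A : Matrix (Fin N) (Fin N) ℝ) (b x₀ : Fin N → ℝ)
    {Ω : Type*} [MeasurableSpace Ω] (P : Measure Ω) [IsProbabilityMeasure P]
    (q : Ω → Fin N → ℝ)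
    (hq_law : ∀ i, HasLaw (fun ω => q ω i) (gaussianReal 0 1) P)
    (hq_indep : iIndepFun (fun (i : Fin N) (ω : Ω) => q ω i) P)
    (ε : ℕ → Ω → ℝ)
    (hρ : ∀ᵐ ω ∂P, ∀ (k : ℕ) (ρ : ℝ),
      MLBiCGStab.ComputesRho A b x₀ (q ω) (fun j => ε j ω) k ρ →
        ρ ≠ 0 ∧ -1 / ρ ∉ spectrum ℝ A)
    (hsol : ∃ y ∈ MLBiCGStab.krylovAffine A b x₀, A *ᵥ y = b) :
    ∀ᵐ ω ∂P,
      (∀ k, MLBiCGStab.run A b x₀ (q ω) (fun j => ε j ω) k ≠ MLBiCGStab.State.breakdown) ∧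
      ∃ (k : ℕ) (x : Fin N → ℝ),
        MLBiCGStab.run A b x₀ (q ω) (fun j => ε j ω) k = MLBiCGStab.State.finished x ∧
        x ∈ MLBiCGStab.krylovAffine A b x₀ ∧ A *ᵥ x = b := by
  obtain ⟨f, hf⟩ := MLBiCGStab.exists_krylovMap_X_mul_eq hsol
  obtain ⟨m, hm0, hm, hmin⟩ :=
    MLBiCGStab.exists_minimal_annihilator A (MLBiCGStab.initialResidual A b x₀)
  have hinj := fun p => MLBiCGStab.krylovMap_eq_zero_of_mulVec (p := p) hf
  filter_upwards [MLBiCGStab.ae_nondegenerate_moment hq_law hq_indep hmin,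
    MLBiCGStab.ae_nondegenerate_shifted_moment hq_law hq_indep hmin hinj, hρ] with ω h0 h1 hω
  exact MLBiCGStab.run_succeeds hm0 hm hinj h0 h1 fun k ρ h => (hω k ρ h).1
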